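/- All graphs are finite, simple and undirected. For a graph $G$, let $\Delta(G)$ denote its maximum degree and let $\rho(G)$ denote its spectral radius, i.e. the largest eigenvalue of its adjacency matrix. Let $k, r \ge 2$ be integers. Then there exists a tree $T$ with $\rho(T) = \sqrt{k}$ and $\Delta(T) = r$ if and only if $\frac{k}{4} + 1 < r \le k$. -/

import Mathlib

/-- The spectral radius `ρ(G)` of a finite simple graph: the largest eigenvalue of its (real)
adjacency matrix. -/
noncomputable def graphSpectralRadius {V : Type*} [Fintype V]
    (G : SimpleGraph V) [DecidableRel G.Adj] : ℝ :=
  sSup {μ : ℝ | Module.End.HasEigenvalue (Matrix.mulVecLin (G.adjMatrix ℝ)) μ}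

/-- On a graph with at least one vertex the supremum above is attained, so that
`graphSpectralRadius G` really is the largest eigenvalue. -/
theorem isGreatest_graphSpectralRadius {V : Type*} [Fintype V] [Nonempty V]
    (G : SimpleGraph V) [DecidableRel G.Adj] :
    IsGreatest {μ : ℝ | Module.End.HasEigenvalue (Matrix.mulVecLin (G.adjMatrix ℝ)) μ}
      (graphSpectralRadius G) := by
  classical
  have hA : (G.adjMatrix ℝ).IsHermitian := by
    rw [Matrix.IsHermitian, Matrix.conjTranspose_eq_transpose_of_trivial]
    exact G.isSymm_adjMatrix
  have heq : {μ : ℝ | Module.End.HasEigenvalue (Matrix.mulVecLin (G.adjMatrix ℝ)) μ} =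
      Set.range hA.eigenvalues := by
    rw [← hA.spectrum_real_eq_range_eigenvalues]
    ext μ
    rw [← Matrix.spectrum_toLin', Set.mem_ofPred_eq, Module.End.hasEigenvalue_iff_mem_spectrum]
    rfl
  unfold graphSpectralRadius
  rw [heq]
  exact (Set.finite_range _).isCompact.isGreatest_sSup (Set.range_nonempty _)

/-!
A vertex `v` of degree `d` forces `ρ ≥ √d`: test the quadratic form on `√d e_v + A e_v`, the Perron
vector of the star around `v`. On a tree with degrees at most `r`, put `s = √(r - 1)`; for large `M`
the function `s⁻ᵈ (M - d²)` of the distance `d` to a root is positive and strictly superharmonic for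
`2s`, so `ρ < 2 √(r - 1)`. With `ρ = √k` these two bounds are `r ≤ k` and `k / 4 + 1 < r`.

For the converse, a positive eigenvector `x` for `√k` on a rooted tree is described by the ratios
`q(v) = √k x(v) / x(parent of v)`: the eigenvalue equation says `k / q = k - ∑ q(child)` below the
root and `∑ q(child) = k` at the root, and a leaf has ratio `1`. So it suffices to write `k` as a
sum of `r` ratios of branches whose vertices have at most `r - 1` children. Write
`k = 4g + 2δ + ε` with `δ, ε ≤ 1`, so that `g + 2 ≤ r`, and put `n = g + δ`. Taking `n` copies of a
branch over and over, with at most `g + 1` children at each vertex, produces in turn the ratios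
`1, 3/2, 5/3, …`, then `2`, then `2 + 1/j` for `j = n - 1, …, 1`, ending with `3`. If `k ≤ 2r` then
`k` is a sum of `r` ratios equal to `1` or `2`. Otherwise `k - n` is a sum of `r - 1` ratios equal
to `1`, `2` or `3`, and the missing ratio `n` belongs to a vertex with `n - 1` children, each of
whose own children again have ratios of sum `k - n`.
-/

open Matrix

theorem exists_abs_mul_le_mulVec {V : Type*} [Fintype V] {A : Matrix V V ℝ}
    (hA : ∀ v w, 0 ≤ A v w) {f x : V → ℝ} (hf : ∀ v, 0 < f v) (hx : x ≠ 0) {μ : ℝ}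
    (hμ : A *ᵥ x = μ • x) : ∃ v, |μ| * f v ≤ (A *ᵥ f) v := by
  obtain ⟨u, hu⟩ := Function.ne_iff.1 hx
  have : Nonempty V := ⟨u⟩
  obtain ⟨v, hv⟩ := Finite.exists_max fun v => |x v| / f v
  set t := |x v| / f v with ht
  have ht_pos : 0 < t := (div_pos (abs_pos.2 hu) (hf u)).trans_le (hv u)
  have hx_le : ∀ w, |x w| ≤ t * f w := fun w => (div_le_iff₀ (hf w)).1 (hv w)
  refine ⟨v, le_of_mul_le_mul_left ?_ ht_pos⟩
  calc t * (|μ| * f v) = |(A *ᵥ x) v| := by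
        rw [hμ, Pi.smul_apply, smul_eq_mul, abs_mul, ht]
        field_simp [(hf v).ne']
    _ ≤ ∑ w, |A v w * x w| := Finset.abs_sum_le_sum_abs _ _
    _ ≤ ∑ w, t * (A v w * f w) := Finset.sum_le_sum fun w _ => by
        rw [abs_mul, abs_of_nonneg (hA v w), mul_left_comm]
        exact mul_le_mul_of_nonneg_left (hx_le w) (hA v w)
    _ = t * (A *ᵥ f) v := (Finset.mul_sum ..).symm

theorem adjMatrix_nonneg {V : Type*} (G : SimpleGraph V) [DecidableRel G.Adj]
    (v w : V) : 0 ≤ G.adjMatrix ℝ v w := by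
  rw [SimpleGraph.adjMatrix_apply]
  positivity

section SpectralRadius

variable {V : Type*} [Fintype V] (G : SimpleGraph V) [DecidableRel G.Adj]

theorem exists_graphSpectralRadius_mul_le [Nonempty V] {f : V → ℝ} (hf : ∀ v, 0 < f v) :
    ∃ v, graphSpectralRadius G * f v ≤ (G.adjMatrix ℝ *ᵥ f) v := by
  obtain ⟨x, hx⟩ := (isGreatest_graphSpectralRadius G).1.exists_hasEigenvector
  obtain ⟨v, hv⟩ := exists_abs_mul_le_mulVec (adjMatrix_nonneg G) hf hx.2 hx.apply_eq_smul
  exact ⟨v, (mul_le_mul_of_nonneg_right (le_abs_self _) (hf v).le).trans hv⟩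

theorem graphSpectralRadius_eq_of_pos [Nonempty V] {x : V → ℝ} {μ : ℝ} (hx : ∀ v, 0 < x v)
    (hμ : G.adjMatrix ℝ *ᵥ x = μ • x) : graphSpectralRadius G = μ := by
  have hx_ne : x ≠ 0 := fun h => (hx (Classical.arbitrary V)).ne' (congrFun h _)
  refine le_antisymm ?_ ((isGreatest_graphSpectralRadius G).2
    (Module.End.hasEigenvalue_of_hasEigenvector
      ⟨Module.End.mem_eigenspace_iff.2 hμ, hx_ne⟩))
  obtain ⟨v, hv⟩ := exists_graphSpectralRadius_mul_le G hx
  rw [hμ] at hv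
  exact le_of_mul_le_mul_right hv (hx v)

theorem dotProduct_adjMatrix_mulVec_le [Nonempty V] (x : V → ℝ) :
    x ⬝ᵥ (G.adjMatrix ℝ *ᵥ x) ≤ graphSpectralRadius G * (x ⬝ᵥ x) := by
  classical
  have hpsd : (algebraMap ℝ (Matrix V V ℝ) (graphSpectralRadius G) - G.adjMatrix ℝ).PosSemidef := by
    rw [Matrix.posSemidef_iff_isHermitian_and_spectrum_nonneg]
    refine ⟨Matrix.IsHermitian.sub (IsSelfAdjoint.algebraMap (Matrix V V ℝ) (.all _)).isHermitian
      (G.isHermitian_adjMatrix ℝ), ?_⟩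
    rw [← spectrum.singleton_sub_eq, Set.singleton_sub]
    rintro _ ⟨μ, hμ, rfl⟩
    rw [← Matrix.spectrum_toLin', ← Module.End.hasEigenvalue_iff_mem_spectrum] at hμ
    exact sub_nonneg.2 ((isGreatest_graphSpectralRadius G).2 hμ)
  have := hpsd.dotProduct_mulVec_nonneg x
  simpa [Matrix.sub_mulVec, dotProduct_sub, Algebra.algebraMap_eq_smul_one, smul_mulVec] using this

theorem graphSpectralRadius_nonneg [Nonempty V] : 0 ≤ graphSpectralRadius G := by
  classical
  simpa using dotProduct_adjMatrix_mulVec_le G (Pi.single (Classical.arbitrary V) 1)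

theorem sqrt_degree_le_graphSpectralRadius (v : V) :
    √(G.degree v : ℝ) ≤ graphSpectralRadius G := by
  classical
  have : Nonempty V := ⟨v⟩
  set s := √(G.degree v : ℝ)
  have hs : s * s = G.degree v := Real.mul_self_sqrt (Nat.cast_nonneg _)
  have hs_nonneg : 0 ≤ s := Real.sqrt_nonneg _
  set A := G.adjMatrix ℝ with hA
  have hA_nonneg : ∀ v w, 0 ≤ A v w := adjMatrix_nonneg G
  set e : V → ℝ := Pi.single v 1
  set a := A *ᵥ e
  have ha : ∀ w, a w = A w v := fun w => congrFun (A.mulVec_single_one v) w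
  have he_e : e ⬝ᵥ e = 1 := by simp [e]
  have he_a : e ⬝ᵥ a = 0 := by simp [e, ha, A]
  have he_Aa : e ⬝ᵥ (A *ᵥ a) = s * s := by
    rw [single_one_dotProduct, hs, ← G.adjMatrix_mul_self_apply_self, Matrix.mul_apply]
    exact Finset.sum_congr rfl fun w _ => by rw [ha]
  have ha_a : a ⬝ᵥ a = s * s := by
    rw [← he_Aa, dotProduct_mulVec e, ← mulVec_transpose, SimpleGraph.transpose_adjMatrix]
  have ha_Aa : 0 ≤ a ⬝ᵥ (A *ᵥ a) := by
    simp only [dotProduct, mulVec, ha]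
    exact Finset.sum_nonneg fun w _ => mul_nonneg (hA_nonneg w v) <|
      Finset.sum_nonneg fun u _ => mul_nonneg (hA_nonneg w u) (hA_nonneg u v)
  have key := dotProduct_adjMatrix_mulVec_le G (s • e + a)
  rw [← hA] at key
  simp only [mulVec_add, mulVec_smul, dotProduct_add, add_dotProduct, smul_dotProduct,
    dotProduct_smul, smul_eq_mul] at key
  change s * (s * e ⬝ᵥ a + a ⬝ᵥ a) + (s * e ⬝ᵥ (A *ᵥ a) + a ⬝ᵥ (A *ᵥ a)) ≤ _ at key
  rw [dotProduct_comm a e, he_e, he_a, he_Aa, ha_a] at key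
  rcases hs_nonneg.eq_or_lt with hs_zero | hs_pos
  · exact hs_zero ▸ graphSpectralRadius_nonneg G
  · exact le_of_mul_le_mul_right (a := 2 * (s * s)) (by linarith) (by positivity)

end SpectralRadius

section UpperBound

variable {V : Type*} {G : SimpleGraph V}

theorem eq_of_adj_of_dist_lt (hG : G.IsTree) {o v w₁ w₂ : V} (h₁ : G.Adj v w₁) (h₂ : G.Adj v w₂)
    (hd₁ : G.dist o w₁ < G.dist o v) (hd₂ : G.dist o w₂ < G.dist o v) : w₁ = w₂ := by
  classical
  obtain ⟨p, hp, -⟩ := hG.connected.exists_path_of_dist o v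
  have eq_penultimate : ∀ w, G.Adj v w → G.dist o w < G.dist o v → w = p.penultimate := by
    intro w hw hd
    obtain ⟨q, hq, hq_len⟩ := hG.connected.exists_path_of_dist o w
    refine hG.isAcyclic.eq_penultimate_of_adj_end hp hw
      (hG.isAcyclic.mem_support_of_ne_mem_support_of_adj_of_isPath hp hq hw fun hv => ?_)
    have := (SimpleGraph.dist_le (q.takeUntil v hv)).trans (q.length_takeUntil_le_length hv)
    omega
  rw [eq_penultimate w₁ h₁ hd₁, eq_penultimate w₂ h₂ hd₂]

theorem sum_neighborFinset_dist_le (hG : G.IsTree) (o v : V) [Fintype (G.neighborSet v)]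
    {h : ℕ → ℝ} (hh : h (G.dist o v + 1) ≤ h (G.dist o v - 1)) :
    ∑ w ∈ G.neighborFinset v, h (G.dist o w) ≤
      h (G.dist o v - 1) + ((G.degree v : ℝ) - 1) * h (G.dist o v + 1) := by
  classical
  set d := G.dist o v
  have h_child : ∀ w ∈ G.neighborFinset v, ¬ G.dist o w < d → h (G.dist o w) = h (d + 1) := by
    intro w hw hlt
    rw [(hG.dist_eq_dist_add_one_of_adj o ((G.mem_neighborFinset v w).1 hw)).resolve_left
      (by omega)]
  by_cases hparent : ∃ p ∈ G.neighborFinset v, G.dist o p < d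
  · obtain ⟨p, hp, hpd⟩ := hparent
    have hp_adj := (G.mem_neighborFinset v p).1 hp
    have hp_dist : G.dist o p = d - 1 := by
      have := (hG.dist_eq_dist_add_one_of_adj o hp_adj).resolve_right (by omega)
      omega
    have h_rest : ∀ w ∈ (G.neighborFinset v).erase p, h (G.dist o w) = h (d + 1) := fun w hw =>
      h_child w (Finset.mem_of_mem_erase hw) fun hlt => Finset.ne_of_mem_erase hw <|
        eq_of_adj_of_dist_lt hG ((G.mem_neighborFinset v w).1 (Finset.mem_of_mem_erase hw))
          hp_adj hlt hpd
    rw [← Finset.add_sum_erase _ _ hp, Finset.sum_congr rfl h_rest, hp_dist, Finset.sum_const,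
      nsmul_eq_mul, Finset.cast_card_erase_of_mem hp, G.card_neighborFinset_eq_degree]
  · push Not at hparent
    rw [Finset.sum_congr rfl fun w hw => h_child w hw (hparent w hw).not_gt, Finset.sum_const,
      nsmul_eq_mul, G.card_neighborFinset_eq_degree]
    linarith

/-- The radial test function `d ↦ s⁻ᵈ (M - d²)` of the distance `d` to the root. Where every vertex
has `s²` children, `s⁻ᵈ` solves the eigenvalue equation for `2s` away from the root; the strictly
concave factor `M - d²` turns this into a strict inequality as long as `d² < M`. -/
noncomputable def radialWeight (s M : ℝ) (d : ℕ) : ℝ := s⁻¹ ^ d * (M - d ^ 2)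

theorem radialWeight_pos {s M : ℝ} (hs : 0 < s) {d : ℕ} (hd : (d : ℝ) ^ 2 < M) :
    0 < radialWeight s M d :=
  mul_pos (by positivity) (sub_pos.2 hd)

theorem radialWeight_succ_le_pred {s M : ℝ} (hs : 1 ≤ s) {d : ℕ} (hd : ((d : ℝ) + 1) ^ 2 ≤ M) :
    radialWeight s M (d + 1) ≤ radialWeight s M (d - 1) := by
  have hs_inv : s⁻¹ ≤ 1 := inv_le_one_of_one_le₀ hs
  have hpred : ((d - 1 : ℕ) : ℝ) ≤ d + 1 := by exact_mod_cast (by omega : d - 1 ≤ d + 1)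
  refine mul_le_mul (pow_le_pow_of_le_one (by positivity) hs_inv (by omega)) ?_ ?_ (by positivity)
  · push_cast
    gcongr
  · push_cast
    linarith

theorem radialWeight_pred_add_lt {s M : ℝ} (hs : 1 ≤ s) {d : ℕ} (hd : (d : ℝ) ^ 2 < M) :
    radialWeight s M (d - 1) + s ^ 2 * radialWeight s M (d + 1) < 2 * s * radialWeight s M d := by
  have : 0 < s := by linarith
  rcases d with _ | d
  · have hM : 0 < M := by simpa using hd
    have hroot : M + s * (M - 1) < 2 * s * M := by
      linarith [mul_nonneg (sub_nonneg.2 hs) hM.le]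
    convert hroot using 1 <;> simp only [radialWeight] <;> push_cast <;> field_simp <;> ring
  · simp only [radialWeight, Nat.add_sub_cancel, pow_succ]
    push_cast
    field_simp
    nlinarith

variable [Fintype V] [DecidableRel G.Adj]

theorem graphSpectralRadius_lt_of_degree_le (hG : G.IsTree) {r : ℕ} (hr : 2 ≤ r)
    (hdeg : ∀ v, G.degree v ≤ r) : graphSpectralRadius G < 2 * √((r : ℝ) - 1) := by
  obtain ⟨o⟩ := hG.connected.nonempty
  obtain ⟨N, hN⟩ := Finite.bddAbove_range (G.dist o)
  have hr' : (2 : ℝ) ≤ r := by exact_mod_cast hr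
  set s := √((r : ℝ) - 1)
  have hs : 1 ≤ s := Real.one_le_sqrt.2 (by linarith)
  have hs_sq : s ^ 2 = r - 1 := Real.sq_sqrt (by linarith)
  set M : ℝ := (N + 2) ^ 2
  have hM : ∀ v, ((G.dist o v : ℝ) + 1) ^ 2 < M := fun v => by
    have : (G.dist o v : ℝ) ≤ N := by exact_mod_cast hN ⟨v, rfl⟩
    exact pow_lt_pow_left₀ (by linarith) (by positivity) two_ne_zero
  have hM' : ∀ v, (G.dist o v : ℝ) ^ 2 < M := fun v =>
    (pow_le_pow_left₀ (by positivity) (by linarith) 2).trans_lt (hM v)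
  have h_next_pos : ∀ v, 0 < radialWeight s M (G.dist o v + 1) := fun v =>
    radialWeight_pos (by linarith) (by exact_mod_cast hM v)
  have hf : ∀ v, 0 < radialWeight s M (G.dist o v) := fun v =>
    radialWeight_pos (by linarith) (hM' v)
  have : Nonempty V := ⟨o⟩
  obtain ⟨v, hv⟩ := exists_graphSpectralRadius_mul_le G hf
  rw [SimpleGraph.adjMatrix_mulVec_apply] at hv
  refine lt_of_mul_lt_mul_right ?_ (hf v).le
  calc graphSpectralRadius G * radialWeight s M (G.dist o v)
      ≤ radialWeight s M (G.dist o v - 1)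
          + ((G.degree v : ℝ) - 1) * radialWeight s M (G.dist o v + 1) :=
        hv.trans (sum_neighborFinset_dist_le hG o v (radialWeight_succ_le_pred hs (hM v).le))
    _ ≤ radialWeight s M (G.dist o v - 1) + s ^ 2 * radialWeight s M (G.dist o v + 1) := by
        gcongr
        · exact (h_next_pos v).le
        · rw [hs_sq]
          gcongr
          exact hdeg v
    _ < 2 * s * radialWeight s M (G.dist o v) := radialWeight_pred_add_lt hs (hM' v)

theorem bounds_of_graphSpectralRadius_eq_sqrt (hG : G.IsTree) {k : ℕ} (hdeg : 2 ≤ G.maxDegree)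
    (hk : graphSpectralRadius G = √(k : ℝ)) :
    (k : ℝ) / 4 + 1 < (G.maxDegree : ℝ) ∧ (G.maxDegree : ℝ) ≤ (k : ℝ) := by
  have := hG.connected.nonempty
  constructor
  · have hlt : √(k : ℝ) < √(2 ^ 2 * ((G.maxDegree : ℝ) - 1)) := by
      rw [← hk, Real.sqrt_mul (by positivity), Real.sqrt_sq zero_le_two]
      exact graphSpectralRadius_lt_of_degree_le hG hdeg G.degree_le_maxDegree
    linarith [(Real.sqrt_lt_sqrt_iff (Nat.cast_nonneg k)).1 hlt]
  · obtain ⟨v, hv⟩ := G.exists_maximal_degree_vertex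
    have hle := sqrt_degree_le_graphSpectralRadius G v
    rwa [hk, ← hv, Real.sqrt_le_sqrt_iff (Nat.cast_nonneg k)] at hle

end UpperBound

section JoinByEdge

variable {V W : Type*}

/-- The disjoint union of `G` and `H` together with one further edge from `v` to `w`. -/
def joinByEdge (G : SimpleGraph V) (H : SimpleGraph W) (v : V) (w : W) : SimpleGraph (V ⊕ W) :=
  (G ⊕g H) ⊔ SimpleGraph.edge (Sum.inl v) (Sum.inr w)

section Adj

variable {G : SimpleGraph V} {H : SimpleGraph W} {v a b : V} {w c d : W}

@[simp]
theorem joinByEdge_adj_inl_inl :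
    (joinByEdge G H v w).Adj (Sum.inl a) (Sum.inl b) ↔ G.Adj a b := by
  simp [joinByEdge, SimpleGraph.edge_adj]

@[simp]
theorem joinByEdge_adj_inl_inr :
    (joinByEdge G H v w).Adj (Sum.inl a) (Sum.inr c) ↔ a = v ∧ c = w := by
  simp [joinByEdge, SimpleGraph.edge_adj]

@[simp]
theorem joinByEdge_adj_inr_inl :
    (joinByEdge G H v w).Adj (Sum.inr c) (Sum.inl a) ↔ c = w ∧ a = v := by
  simp [joinByEdge, SimpleGraph.edge_adj]

@[simp]
theorem joinByEdge_adj_inr_inr :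
    (joinByEdge G H v w).Adj (Sum.inr c) (Sum.inr d) ↔ H.Adj c d := by
  simp [joinByEdge, SimpleGraph.edge_adj]

end Adj

theorem isTree_joinByEdge [Finite V] [Finite W] {G : SimpleGraph V} {H : SimpleGraph W}
    (hG : G.IsTree) (hH : H.IsTree) (v : V) (w : W) : (joinByEdge G H v w).IsTree := by
  have hconn := hG.connected.sum_sup_edge (v := v) (w := w) hH.connected
  rw [SimpleGraph.isTree_iff_connected_and_card] at hG hH ⊢
  have hedges : (joinByEdge G H v w).edgeSet =
      insert s(Sum.inl v, Sum.inr w) (G ⊕g H).edgeSet := by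
    rw [joinByEdge, SimpleGraph.edgeSet_sup, SimpleGraph.edgeSet_edge_of_ne Sum.inl_ne_inr,
      Set.insert_eq, Set.union_comm]
  have hcard : Nat.card (G ⊕g H).edgeSet = Nat.card G.edgeSet + Nat.card H.edgeSet := by
    rw [Nat.card_congr SimpleGraph.edgeSetSumEquiv, Nat.card_sum]
  refine ⟨hconn, ?_⟩
  rw [hedges, Nat.card_coe_set_eq, Set.ncard_insert_of_notMem (by simp), ← Nat.card_coe_set_eq,
    hcard, Nat.card_sum]
  omega

variable [Fintype V] [Fintype W] (G : SimpleGraph V) (H : SimpleGraph W) (v : V) (w : W)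
  [DecidableRel (joinByEdge G H v w).Adj]

theorem adjMatrix_joinByEdge_mulVec_inl [DecidableRel G.Adj] [DecidableEq V] (x : V → ℝ)
    (y : W → ℝ) (u : V) :
    ((joinByEdge G H v w).adjMatrix ℝ *ᵥ Sum.elim x y) (Sum.inl u) =
      (G.adjMatrix ℝ *ᵥ x) u + if u = v then y w else 0 := by
  classical
  simp only [mulVec, dotProduct, Fintype.sum_sum_type, SimpleGraph.adjMatrix_apply,
    joinByEdge_adj_inl_inl, joinByEdge_adj_inl_inr, Sum.elim_inl, Sum.elim_inr]
  by_cases huv : u = v <;> simp [huv]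

theorem adjMatrix_joinByEdge_mulVec_inr [DecidableRel H.Adj] [DecidableEq W] (x : V → ℝ)
    (y : W → ℝ) (u : W) :
    ((joinByEdge G H v w).adjMatrix ℝ *ᵥ Sum.elim x y) (Sum.inr u) =
      (H.adjMatrix ℝ *ᵥ y) u + if u = w then x v else 0 := by
  classical
  simp only [mulVec, dotProduct, Fintype.sum_sum_type, SimpleGraph.adjMatrix_apply,
    joinByEdge_adj_inr_inl, joinByEdge_adj_inr_inr, Sum.elim_inl, Sum.elim_inr]
  by_cases huw : u = w <;> simp [huw, add_comm]

theorem degree_joinByEdge_inl [DecidableRel G.Adj] [DecidableEq V] (u : V) :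
    (joinByEdge G H v w).degree (Sum.inl u) = G.degree u + if u = v then 1 else 0 := by
  have h := adjMatrix_joinByEdge_mulVec_inl G H v w (Function.const V 1) (Function.const W 1) u
  rw [Sum.elim_const_const, SimpleGraph.adjMatrix_mulVec_const_apply,
    SimpleGraph.adjMatrix_mulVec_const_apply] at h
  simp only [Function.const_apply, mul_one] at h
  exact_mod_cast h

theorem degree_joinByEdge_inr [DecidableRel H.Adj] [DecidableEq W] (u : W) :
    (joinByEdge G H v w).degree (Sum.inr u) = H.degree u + if u = w then 1 else 0 := by
  have h := adjMatrix_joinByEdge_mulVec_inr G H v w (Function.const V 1) (Function.const W 1) u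
  rw [Sum.elim_const_const, SimpleGraph.adjMatrix_mulVec_const_apply,
    SimpleGraph.adjMatrix_mulVec_const_apply] at h
  simp only [Function.const_apply, mul_one] at h
  exact_mod_cast h

end JoinByEdge

/-- `G` is a tree in which the root `o` has degree `n` and every other vertex has degree at most
`r`. -/
structure IsRootedTree {V : Type*} [Fintype V] (r : ℕ) (G : SimpleGraph V) [DecidableRel G.Adj]
    (o : V) (n : ℕ) : Prop where
  isTree : G.IsTree
  degree_root : G.degree o = n
  degree_le_of_ne : ∀ v ≠ o, G.degree v ≤ r

/-- `x` is a positive vector which satisfies the equation of an eigenvector for `√k` at every vertex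
except possibly the root `o`, where it defines the weight `S` instead: an eigenvector is the case
`S = k`. -/
structure IsRootedEigenvector {V : Type*} [Fintype V] (k : ℝ) (G : SimpleGraph V)
    [DecidableRel G.Adj] (o : V) (x : V → ℝ) (S : ℝ) : Prop where
  pos : ∀ v, 0 < x v
  mulVec_of_ne : ∀ v ≠ o, (G.adjMatrix ℝ *ᵥ x) v = √k * x v
  mulVec_root : √k * (G.adjMatrix ℝ *ᵥ x) o = S * x o

section Attach

variable {V W : Type*} [Fintype V] [Fintype W] {G : SimpleGraph V} [DecidableRel G.Adj]
  {H : SimpleGraph W} [DecidableRel H.Adj] {o : V} {p : W} [DecidableRel (joinByEdge G H o p).Adj]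

theorem IsRootedTree.joinByEdge {r m n : ℕ} (hG : IsRootedTree r G o m)
    (hH : IsRootedTree r H p n) (hn : n < r) :
    IsRootedTree r (joinByEdge G H o p) (Sum.inl o) (m + 1) := by
  classical
  refine ⟨isTree_joinByEdge hG.isTree hH.isTree o p, ?_, ?_⟩
  · rw [degree_joinByEdge_inl, if_pos rfl, hG.degree_root]
  rintro (v | w) hv
  · have hvo : v ≠ o := fun h => hv (congrArg _ h)
    rw [degree_joinByEdge_inl, if_neg hvo]
    exact hG.degree_le_of_ne v hvo
  · rw [degree_joinByEdge_inr]
    split_ifs with hw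
    · rw [hw, hH.degree_root]
      exact hn
    · exact hH.degree_le_of_ne w hw

theorem IsRootedEigenvector.exists_joinByEdge {k S T : ℝ} {x : V → ℝ} {y : W → ℝ}
    (hx : IsRootedEigenvector k G o x S) (hy : IsRootedEigenvector k H p y T) (hk : 0 < k)
    (hT : T < k) :
    ∃ c : ℝ, IsRootedEigenvector k (joinByEdge G H o p) (Sum.inl o) (Sum.elim x (c • y))
      (S + k / (k - T)) := by
  classical
  have hsqrt : √k * √k = k := Real.mul_self_sqrt hk.le
  have hkT : 0 < k - T := sub_pos.2 hT
  have hxo := hx.pos o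
  have hyp := hy.pos p
  set c := √k * x o / ((k - T) * y p) with hc
  have hc_pos : 0 < c := by positivity
  have hc_mul : c * ((k - T) * y p) = √k * x o := div_mul_cancel₀ _ (by positivity)
  refine ⟨c, ?_, ?_, ?_⟩
  · rintro (v | w)
    exacts [hx.pos v, mul_pos hc_pos (hy.pos w)]
  · rintro (v | w) hv
    · have hvo : v ≠ o := fun h => hv (congrArg _ h)
      rw [adjMatrix_joinByEdge_mulVec_inl, if_neg hvo, add_zero]
      exact hx.mulVec_of_ne v hvo
    · rw [adjMatrix_joinByEdge_mulVec_inr, mulVec_smul]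
      simp only [Pi.smul_apply, smul_eq_mul, Sum.elim_inr]
      split_ifs with hw
      · subst hw
        refine mul_left_cancel₀ (Real.sqrt_pos.2 hk).ne' ?_
        linear_combination c * hy.mulVec_root - hc_mul - c * y w * hsqrt
      · rw [hy.mulVec_of_ne w hw]
        ring
  · rw [adjMatrix_joinByEdge_mulVec_inl, if_pos rfl, mul_add, hx.mulVec_root]
    simp only [Pi.smul_apply, smul_eq_mul, Sum.elim_inl]
    rw [hc]
    field_simp
    linear_combination hsqrt

end Attach

/-- Some finite rooted tree whose root has `n` children and whose other vertices have degree at most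
`r` carries a rooted eigenvector for `√k` of weight `S`. -/
def RootWeight (k : ℝ) (r n : ℕ) (S : ℝ) : Prop :=
  ∃ (V : Type) (_ : Fintype V) (G : SimpleGraph V) (_ : DecidableRel G.Adj) (o : V) (x : V → ℝ),
    IsRootedTree r G o n ∧ IsRootedEigenvector k G o x S

namespace RootWeight

variable {k : ℝ} {r : ℕ}

theorem single : RootWeight k r 0 0 :=
  ⟨Unit, inferInstance, ⊥, inferInstance, (), 1,
    ⟨.of_subsingleton, by simp, fun v hv => absurd rfl hv⟩,
    ⟨fun _ => one_pos, fun v hv => absurd rfl hv, by simp⟩⟩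

theorem attach (hk : 0 < k) {m n : ℕ} {S T : ℝ} (hS : RootWeight k r m S)
    (hT : RootWeight k r n T) (hn : n < r) (hTk : T < k) :
    RootWeight k r (m + 1) (S + k / (k - T)) := by
  classical
  obtain ⟨V, _, G, _, o, x, hG, hx⟩ := hS
  obtain ⟨W, _, H, _, p, y, hH, hy⟩ := hT
  obtain ⟨c, hc⟩ := hx.exists_joinByEdge hy hk hTk
  exact ⟨V ⊕ W, inferInstance, joinByEdge G H o p, Classical.decRel _, Sum.inl o, _,
    hG.joinByEdge hH hn, hc⟩

theorem exists_tree (hk : 0 < k) (h : RootWeight k r r k) :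
    ∃ (V : Type) (_ : Fintype V) (T : SimpleGraph V) (_ : DecidableRel T.Adj),
      T.IsTree ∧ graphSpectralRadius T = √k ∧ T.maxDegree = r := by
  obtain ⟨V, hV, G, hdec, o, x, hG, hx⟩ := h
  have : Nonempty V := ⟨o⟩
  refine ⟨V, hV, G, hdec, hG.isTree, graphSpectralRadius_eq_of_pos G hx.pos (funext fun v => ?_),
    le_antisymm (G.maxDegree_le_of_forall_degree_le r fun v => ?_) ?_⟩
  · rcases eq_or_ne v o with rfl | hv
    · refine mul_left_cancel₀ (Real.sqrt_pos.2 hk).ne' ?_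
      rw [hx.mulVec_root, Pi.smul_apply, smul_eq_mul, ← mul_assoc, Real.mul_self_sqrt hk.le]
    · exact hx.mulVec_of_ne v hv
  · rcases eq_or_ne v o with rfl | hv
    exacts [hG.degree_root.le, hG.degree_le_of_ne v hv]
  · exact hG.degree_root ▸ G.degree_le_maxDegree o

end RootWeight

/-- A branch of ratio `q` is a rooted tree that may be hung below a vertex: `q` is `√k` times the
entry of its root divided by the entry of its parent, which is determined by the weight `T` of the
branch as `q = k / (k - T)`. -/
def IsBranchRatio (k : ℝ) (r : ℕ) (q : ℝ) : Prop :=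
  ∃ n T, n < r ∧ T < k ∧ RootWeight k r n T ∧ k / (k - T) = q

section BranchRatio

variable {k : ℝ} {r : ℕ}

theorem isBranchRatio_one (hk : 0 < k) (hr : 0 < r) : IsBranchRatio k r 1 :=
  ⟨0, 0, hr, hk, .single, by rw [sub_zero, div_self hk.ne']⟩

theorem RootWeight.add_copies (hk : 0 < k) {m : ℕ} {S q : ℝ} (hS : RootWeight k r m S) (c : ℕ)
    (hq : 0 < c → IsBranchRatio k r q) : RootWeight k r (m + c) (S + c * q) := by
  induction c with
  | zero => simpa using hS
  | succ c ih =>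
    obtain ⟨n, T, hn, hTk, hT, rfl⟩ := hq c.succ_pos
    have h := (ih fun _ => hq c.succ_pos).attach hk hT hn hTk
    rw [add_assoc m, add_assoc S, ← add_one_mul, ← Nat.cast_succ] at h
    exact h

theorem RootWeight.star (hk : 0 < k) (hr : 0 < r) (c : ℕ) : RootWeight k r c c := by
  simpa using single.add_copies hk c fun _ => isBranchRatio_one hk hr

theorem RootWeight.isBranchRatio_div_sub (hk : 0 < k) {m n : ℕ} {D : ℝ}
    (h : RootWeight k r m (k - D)) (hm : m < r) (hn : n < r) (hnD : n < D) :
    IsBranchRatio k r (D / (D - n)) := by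
  have hD : 0 < D := n.cast_nonneg.trans_lt hnD
  have hchild : IsBranchRatio k r (k / D) := ⟨m, k - D, hm, by linarith, h, by rw [sub_sub_cancel]⟩
  have hparent := single.add_copies hk n fun _ => hchild
  rw [zero_add, zero_add] at hparent
  have hsub : k - n * (k / D) = k * ((D - n) / D) := by field_simp
  have hpos : 0 < (D - n) / D := div_pos (sub_pos.2 hnD) hD
  refine ⟨n, _, hn, sub_pos.1 (hsub ▸ mul_pos hk hpos), hparent, ?_⟩
  rw [hsub]
  field_simp

theorem RootWeight.of_isBranchRatio_two_three (hk : 0 < k) (hr : 0 < r)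
    (h2 : IsBranchRatio k r 2) (h3 : IsBranchRatio k r 3) {c S : ℕ} (hc : c ≤ S) (hS : S ≤ 3 * c) :
    RootWeight k r c S := by
  have h := ((star hk hr (c - (S - c) / 2 - (S - c) % 2)).add_copies hk ((S - c) % 2)
    fun _ => h2).add_copies hk ((S - c) / 2) fun _ => h3
  convert h using 1
  · omega
  · exact_mod_cast (by omega)

end BranchRatio

section Levels

variable {k r g δ ε : ℕ}

/-- A vertex of weight `k - n(2 + z)`, where `n = g + δ`, has ratio `k / (n(2 + z))`, so a parent
with exactly `n` such children has ratio `(2 + z) / (1 + z)`. The cases `z = 1 / x`, `z = 0` and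
`z = -1 / (j + 1)` give the ratios `2 - 1 / (x + 1)`, `2` and `2 + 1 / j`. -/
theorem RootWeight.isBranchRatio_level (hk : k = 4 * g + 2 * δ + ε) (hδ : δ ≤ 1) (hr : g + 2 ≤ r)
    (hn : 0 < g + δ) {m : ℕ} (hm : m ≤ g + 1) {S z : ℝ} (h : RootWeight k r m S)
    (hS : S = 2 * g + ε - (g + δ) * z) (hz : -1 < z) :
    IsBranchRatio k r ((2 + z) / (1 + z)) := by
  have hk_pos : (0 : ℝ) < k := by exact_mod_cast (by omega)
  have hn_pos : (0 : ℝ) < (g + δ : ℕ) := by exact_mod_cast hn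
  have hweight : S = k - (g + δ : ℕ) * (2 + z) := by
    rw [hS, hk]
    push_cast
    ring
  rw [hweight] at h
  have hratio := h.isBranchRatio_div_sub (n := g + δ) hk_pos (by omega) (by omega) (by nlinarith)
  rwa [← mul_sub_one, mul_div_mul_left _ _ hn_pos.ne', show 2 + z - 1 = 1 + z by ring] at hratio

theorem isBranchRatio_two_sub_inv (hk : k = 4 * g + 2 * δ + ε) (hδ : δ ≤ 1) (hε : ε ≤ 1)
    (hk_pos : (0 : ℝ) < k) (hr : g + 2 ≤ r) {i : ℕ} (hi : i ≤ g) :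
    IsBranchRatio k r (2 - 1 / (i + 1)) := by
  induction i using Nat.twoStepInduction with
  | zero =>
    convert isBranchRatio_one hk_pos (by omega : 0 < r) using 1
    norm_num
  | one =>
    have h := RootWeight.star hk_pos (by omega : 0 < r) (g + ε - δ)
    have hsum : ((g + ε - δ : ℕ) : ℝ) = 2 * g + ε - (g + δ) * 1 := by
      push_cast [Nat.cast_sub (by omega : δ ≤ g + ε)]
      ring
    convert h.isBranchRatio_level hk hδ hr (by omega) (by omega) hsum (by norm_num) using 1
    norm_num
  | more i ih₀ ih₁ =>
    have hcount : δ * (i + 2) ≤ g + δ := by interval_cases δ <;> omega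
    have hcount' : ε + δ * (i + 1) + (g + δ - δ * (i + 2)) ≤ g + 1 := by
      interval_cases δ <;> omega
    have h := ((RootWeight.star hk_pos (by omega : 0 < r) ε).add_copies hk_pos (δ * (i + 1))
      fun _ => ih₀ (by omega)).add_copies hk_pos (g + δ - δ * (i + 2)) fun _ => ih₁ (by omega)
    have hsum : (ε + (δ * (i + 1) : ℕ) * (2 - 1 / (i + 1)) +
        (g + δ - δ * (i + 2) : ℕ) * (2 - 1 / ((i + 1 : ℕ) + 1)) : ℝ) =
          2 * g + ε - (g + δ) * (1 / (i + 2)) := by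
      push_cast [Nat.cast_sub hcount]
      field_simp
      ring
    convert h.isBranchRatio_level hk hδ hr (by omega) hcount' hsum
      (neg_one_lt_zero.trans (by positivity)) using 1
    push_cast
    field_simp
    ring

theorem isBranchRatio_two (hk : k = 4 * g + 2 * δ + ε) (hδ : δ ≤ 1) (hε : ε ≤ 1) (hk3 : 3 ≤ k)
    (hr : g + 2 ≤ r) : IsBranchRatio k r 2 := by
  have hk_pos : (0 : ℝ) < k := by exact_mod_cast (by omega)
  obtain ⟨i, hi⟩ : ∃ i, g + ε = i + 1 := ⟨g + ε - 1, by omega⟩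
  have h := (RootWeight.star hk_pos (by omega : 0 < r) (1 - ε)).add_copies hk_pos (i + 1)
    fun _ => isBranchRatio_two_sub_inv hk hδ hε hk_pos hr (by omega : i ≤ g)
  have hsum : ((1 - ε : ℕ) + (i + 1 : ℕ) * (2 - 1 / (i + 1)) : ℝ) =
      2 * g + ε - (g + δ) * 0 := by
    have : (g : ℝ) + ε = i + 1 := by exact_mod_cast hi
    push_cast [Nat.cast_sub hε]
    field_simp
    linarith
  convert h.isBranchRatio_level hk hδ hr (by omega) (by omega) hsum (by norm_num) using 1
  norm_num

theorem isBranchRatio_two_add_inv_of_succ (hk : k = 4 * g + 2 * δ + ε) (hδ : δ ≤ 1) (hε : ε ≤ 1)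
    (hr : g + 2 ≤ r) {j : ℕ} (hj_pos : 0 < j) (hj : j < g + δ)
    (h_succ : j + 1 < g + δ → IsBranchRatio k r (2 + 1 / (j + 1 : ℕ))) :
    IsBranchRatio k r (2 + 1 / j) := by
  have hk_pos : (0 : ℝ) < k := by exact_mod_cast (by omega)
  have hj_pos' : (0 : ℝ) < j := by exact_mod_cast hj_pos
  have h := ((RootWeight.star hk_pos (by omega : 0 < r) (1 - ε)).add_copies hk_pos (j + 1 + ε - δ)
    fun _ => isBranchRatio_two hk hδ hε (by omega) hr).add_copies hk_pos (g + δ - (j + 1))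
    fun h => h_succ (by omega)
  have hsum : ((1 - ε : ℕ) + (j + 1 + ε - δ : ℕ) * 2 +
      (g + δ - (j + 1) : ℕ) * (2 + 1 / (j + 1 : ℕ)) : ℝ) =
        2 * g + ε - (g + δ) * (-(1 / (j + 1))) := by
    push_cast [Nat.cast_sub hε, Nat.cast_sub (by omega : j + 1 ≤ g + δ),
      Nat.cast_sub (by omega : δ ≤ j + 1 + ε)]
    field_simp
    ring
  have hz : (-1 : ℝ) < -(1 / (j + 1)) := neg_lt_neg ((div_lt_one (by linarith)).2 (by linarith))
  convert h.isBranchRatio_level hk hδ hr (by omega) (by omega) hsum hz using 1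
  have hz' : 1 + -(1 / (j + 1) : ℝ) = j / (j + 1) := by field_simp; ring
  rw [hz']
  field_simp
  ring

theorem isBranchRatio_three (hk : k = 4 * g + 2 * δ + ε) (hδ : δ ≤ 1) (hε : ε ≤ 1)
    (hn : 2 ≤ g + δ) (hr : g + 2 ≤ r) : IsBranchRatio k r 3 := by
  have h := Nat.decreasingInduction' (P := fun j => j < g + δ → IsBranchRatio k r (2 + 1 / j))
    (fun j hj hj_pos ih _ => isBranchRatio_two_add_inv_of_succ hk hδ hε hr hj_pos hj ih)
    (by omega : 1 ≤ g + δ) (fun h => absurd h (lt_irrefl _)) (by omega)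
  convert h using 1
  norm_num

theorem rootWeight_self_of_le_two_mul (hr : k + 4 < 4 * r) (hrk : r ≤ k) (hk : k ≤ 2 * r) :
    RootWeight k r r k := by
  have hk_pos : (0 : ℝ) < k := by exact_mod_cast (by omega)
  have h := (RootWeight.star hk_pos (by omega : 0 < r) (2 * r - k)).add_copies hk_pos (k - r)
    fun _ => isBranchRatio_two (g := k / 4) (δ := k / 2 % 2) (ε := k % 2) (by omega) (by omega)
      (by omega) (by omega) (by omega)
  convert h using 1
  · omega
  · push_cast [Nat.cast_sub hrk, Nat.cast_sub hk]
    ring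

theorem rootWeight_self_of_two_mul_lt (hr : k + 4 < 4 * r) (hk : 2 * r < k) :
    RootWeight k r r k := by
  have hk_pos : (0 : ℝ) < k := by exact_mod_cast (by omega)
  obtain ⟨g, δ, ε, hk_eq, hδ, hε⟩ : ∃ g δ ε, k = 4 * g + 2 * δ + ε ∧ δ ≤ 1 ∧ ε ≤ 1 :=
    ⟨k / 4, k / 2 % 2, k % 2, by omega, by omega, by omega⟩
  have h2 := isBranchRatio_two hk_eq hδ hε (by omega) (by omega : g + 2 ≤ r)
  have h3 := isBranchRatio_three hk_eq hδ hε (by omega) (by omega : g + 2 ≤ r)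
  have hrest := RootWeight.of_isBranchRatio_two_three hk_pos (by omega) h2 h3
    (by omega : r - 1 ≤ k - (g + δ)) (by omega)
  rw [Nat.cast_sub (by omega)] at hrest
  have hlast := hrest.isBranchRatio_div_sub (n := g + δ - 1) hk_pos (by omega) (by omega)
    (by exact_mod_cast (by omega))
  convert hrest.add_copies hk_pos 1 fun _ => hlast using 1
  · omega
  · push_cast [Nat.cast_sub (by omega : 1 ≤ g + δ)]
    ring_nf

end Levels

theorem mainTheorem2 (k r : ℕ) (hk : 2 ≤ k) (hr : 2 ≤ r) :
    (∃ (V : Type) (_ : Fintype V) (T : SimpleGraph V) (_ : DecidableRel T.Adj),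
        T.IsTree ∧ graphSpectralRadius T = Real.sqrt (k : ℝ) ∧ T.maxDegree = r) ↔
      ((k : ℝ) / 4 + 1 < (r : ℝ) ∧ (r : ℝ) ≤ (k : ℝ)) := by
  constructor
  · rintro ⟨V, _, T, _, hT, hρ, rfl⟩
    exact bounds_of_graphSpectralRadius_eq_sqrt hT hr hρ
  · rintro ⟨hlt, hle⟩
    have hlt' : k + 4 < 4 * r := by
      rify
      linarith
    have hle' : r ≤ k := by exact_mod_cast hle
    refine RootWeight.exists_tree (Nat.cast_pos.2 (by omega)) ?_
    rcases le_or_gt k (2 * r) with hk2 | hk2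
    · exact rootWeight_self_of_le_two_mul (by omega) hle' hk2
    · exact rootWeight_self_of_two_mul_lt (by omega) hk2
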